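/- **Theorem (Degree distribution).** Let $\alpha\in(0,1]$ and let $P$ be a probability distribution on $\mathbb{N}=\{0,1,2,\dots\}$. Let $(G_1,G_2,\dots)$ be a sequence of random multigraphs with law $\mathrm{RW}_{\mathrm{SB}}(\alpha,P)$, that is, the Markov chain defined as follows. $G_1$ is a single edge connecting two vertices. Given $G_t$ (with $t\ge 1$), select a vertex $V$ of $G_t$ from the size-biased distribution $\mathbb{S}(v)=\deg(v)/\sum_{v'}\deg(v')$. With probability $\alpha$, attach a new vertex to $V$ by one edge. Otherwise draw $K\sim P$ independently, let $V'$ be the terminal vertex of a simple random walk of length $K$ on $G_t$ started at $V$, and add an edge between $V$ and $V'$ (parallel edges and self-loops are allowed). Here the degree of a vertex is the number of edge ends at it, so that a self-loop counts twice, and $k$ steps of the simple random walk have the transition matrix $(D^{-1}A)^k$, with $D$ the diagonal matrix of degrees and $A$ the adjacency matrix, whose entry $A_{uv}$ is the number of edges between $u$ and $v$ if $u\neq v$, and twice the number of self-loops at $u$ if $u=v$. Let $\mathcal{V}_{d,t}$ be the set of vertices of degree $d$ in $G_t$, let $m_{d,t}=|\mathcal{V}_{d,t}|$, and for a vertex $v$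 of $G_t$ let $$\mathbb{P}(V_{\mathrm{end}}=v\mid V_0=v,G_t)=\sum_{k\ge 0}P(\{k\})\,\bigl[(D^{-1}A)^k\bigr]_{vv}$$ be the probability that a simple random walk on $G_t$ of random length with law $P$, started at $v$, ends at $v$. Assume that for each integer $d\ge 1$ $$\frac{1}{m_{d,t}}\sum_{v\in\mathcal{V}_{d,t}}\mathbb{P}(V_{\mathrm{end}}=v\mid V_0=v,G_t)\;\longrightarrow\;0\quad\text{in probability as }t\to\infty,$$ where the left side is read as $0$ if $m_{d,t}=0$. Let $\rho=1+\frac{\alpha}{2-\alpha}$ and let $$p_d=\rho\,\frac{\Gamma(d)\,\Gamma(1+\rho)}{\Gamma(d+1+\rho)},\qquad d\ge 1,$$ be the Yule–Simon distribution with parameter $\rho$. Then for every integer $d\ge 1$ $$\frac{m_{d,t}}{\alpha t}\longrightarrow p_d\quad\text{in probability as }t\to\infty,$$ and $(p_d)$ is a power law with exponent $1+\rho$: $\;p_d\sim\rho\,\Gamma(1+\rho)\,d^{-(1+\rho)}$ as $d\to\infty$. -/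

import Mathlib

open MeasureTheory Filter Topology
open scoped Asymptotics

noncomputable section

/-- A finite undirected multigraph on the vertex set `{0, …, n - 1}`. Vertices are labelled in their
order of appearance. Edges form a multiset of unordered pairs, so that parallel edges and self-loops
are allowed. -/
structure Multigraph where
  /-- the number of vertices -/
  n : ℕ
  /-- the edges, with multiplicity -/
  edges : Multiset (Sym2 (Fin n))

namespace Multigraph

/-- Multigraphs form a countable set of states, with the discrete σ-algebra. -/
instance instMeasurableSpace : MeasurableSpace Multigraph := ⊤

/-- A single edge connecting two vertices. -/
def singleEdge : Multigraph := ⟨2, {s(0, 1)}⟩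

/-- Attach a new vertex (with label `g.n`) to the vertex `v` by one new edge. -/
def attach (g : Multigraph) (v : Fin g.n) : Multigraph :=
  ⟨g.n + 1, s(v.castSucc, Fin.last g.n) ::ₘ g.edges.map (Sym2.map Fin.castSucc)⟩

/-- Add one edge between the (possibly equal) vertices `v` and `w`. -/
def addEdge (g : Multigraph) (v w : Fin g.n) : Multigraph :=
  ⟨g.n, s(v, w) ::ₘ g.edges⟩

/-- Adjacency matrix: off the diagonal the number of edges between `u` and `v`; on the diagonal twice
the number of self-loops, since both ends of a self-loop lie at the vertex. -/
def adj (g : Multigraph) (u v : Fin g.n) : ℕ :=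
  (if u = v then 2 else 1) * g.edges.count s(u, v)

/-- Degree: the number of edge ends at `v` (a self-loop counts twice). -/
def deg (g : Multigraph) (v : Fin g.n) : ℕ := ∑ u, g.adj v u

/-- The set of vertices of degree `d`. -/
def degSet (g : Multigraph) (d : ℕ) : Finset (Fin g.n) := {v | g.deg v = d}

/-- The number `m_d` of vertices of degree `d`. -/
def degCount (g : Multigraph) (d : ℕ) : ℕ := (g.degSet d).card

/-- The size-biased distribution on the vertices. -/
def sizeBiased (g : Multigraph) (v : Fin g.n) : ℝ := (g.deg v : ℝ) / ∑ u, (g.deg u : ℝ)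

/-- One-step transition matrix `D⁻¹ A` of the simple random walk on `g`: the walker crosses an edge
chosen uniformly among the edge ends at its current vertex. -/
def walkMatrix (g : Multigraph) : Matrix (Fin g.n) (Fin g.n) ℝ :=
  Matrix.of fun u v => (g.adj u v : ℝ) / (g.deg u : ℝ)

/-- `g.walkProb P u v` is the probability that a simple random walk on `g`, started at `u` and of
random length `K` with law `P`, independent of the steps, ends at `v`. -/
def walkProb (g : Multigraph) (P : PMF ℕ) (u v : Fin g.n) : ℝ :=
  ∑' k : ℕ, (P k).toReal * (g.walkMatrix ^ k) u v

/-- The average over the vertices of degree `d` of the probability that the walk ends where it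
started (`0` if there are no vertices of degree `d`). -/
def avgReturn (g : Multigraph) (P : PMF ℕ) (d : ℕ) : ℝ :=
  (∑ v ∈ g.degSet d, g.walkProb P v v) / (g.degCount d : ℝ)

open Classical in
/-- One-step transition probabilities from `g` to `h` of the size-biased random walk model: select a
size-biased vertex `v`; with probability `α` attach a new vertex to `v`; otherwise connect `v` to the
end `w` of a simple random walk on `g` that starts at `v` and whose length has law `P`. -/
def stepProb (α : ℝ) (P : PMF ℕ) (g h : Multigraph) : ℝ :=
  ∑ v, g.sizeBiased v *
    (α * (if h = g.attach v then 1 else 0) +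
      (1 - α) * ∑ w, g.walkProb P v w * (if h = g.addEdge v w then 1 else 0))

end Multigraph

open Classical in
/-- The sequence `(G 1, G 2, …)` of random multigraphs on the probability space `(Ω, μ)` has the law
of the size-biased random walk model with parameters `α` and `P`: its finite-dimensional
distributions are those of the Markov chain that starts at a single edge and has transition
probabilities `stepProb α P`. The value `G 0` plays no role. -/
structure IsRWSB {Ω : Type*} [MeasurableSpace Ω] (μ : Measure Ω) (α : ℝ) (P : PMF ℕ)
    (G : ℕ → Ω → Multigraph) : Prop where
  measurable : ∀ t, 1 ≤ t → Measurable (G t)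
  law : ∀ t, 1 ≤ t → ∀ g : ℕ → Multigraph,
    μ.real {ω | ∀ s ∈ Finset.Icc 1 t, G s ω = g s} =
      (if g 1 = Multigraph.singleEdge then 1 else 0) *
        ∏ s ∈ Finset.Ico 1 t, Multigraph.stepProb α P (g s) (g (s + 1))

/-- The weights of the Yule–Simon distribution on `{1, 2, …}` with parameter `ρ`. -/
def yuleSimon (ρ : ℝ) (d : ℕ) : ℝ :=
  ρ * (Real.Gamma d * Real.Gamma (1 + ρ) / Real.Gamma (d + 1 + ρ))

end

/-! The size-biased law is stationary for the simple random walk, so the far end of a new edge is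
size-biased whatever `P` is. A step therefore raises the degree of α + 2(1 − α) = 2 − α size-biased
vertices on average. Given G_t, the mean change of m_d is α·1[d = 1] + (2 − α)((d − 1)m_{d−1} −
d·m_d)/(2t), up to a correction for self-loops (`Reachable.stepMean_degCount`). That correction is
controlled by the return probabilities, which vanish by hypothesis.

Put κ = α·p_d and Y_t = m_{d,t} − κt. Since (2 − α)ρ/2 = 1, the recurrence `yuleSimon_recurrence`
says exactly that the constants in the drift cancel. What is left is E[Y_{t+1} − Y_t | G_t] =
−(c/t)Y_t + e_t with c ≥ 0, where e_t collects the deviation of m_{d−1} and the self-loops.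
Squaring, the reverting term only helps; as |Y_t| = O(t) and increments are bounded, E Y_{t+1}² ≤ E
Y_t² + O(t)·E|e_t| + O(1). If E|e_t| → 0, then E Y_t² = o(t²), and Chebyshev concludes. Induction on
d supplies E|e_t| → 0, because m_{d−1}/t is bounded and so converges in mean as well.

The power law is Euler's limit formula for Γ(ρ). -/

/-! ### Degrees and degree counts under the two moves. -/

/-- Number of edge ends at `u` in a multiset of edges that lead to `v`, as in `Multigraph.adj`. -/
def edgeAdj {n : ℕ} (E : Multiset (Sym2 (Fin n))) (u v : Fin n) : ℕ :=
  (if u = v then 2 else 1) * E.count s(u, v)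

/-- Number of edge ends at `u` in a multiset of edges. -/
def edgeDeg {n : ℕ} (E : Multiset (Sym2 (Fin n))) (u : Fin n) : ℕ := ∑ v, edgeAdj E u v

/-- A sum of two products rather than a disjunction: for a loop at a = b both are 1, which gives the
2 on the diagonal. Working with multisets over a fixed `Fin n` keeps the vertex type of the new
graph out of the rewriting. -/
theorem edgeAdj_cons {n : ℕ} (E : Multiset (Sym2 (Fin n))) (v w a b : Fin n) :
    edgeAdj (s(v, w) ::ₘ E) a b = edgeAdj E a b +
      ((if a = v then 1 else 0) * (if b = w then 1 else 0) +
        (if a = w then 1 else 0) * (if b = v then 1 else 0)) := by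
  simp only [edgeAdj, Multiset.count_cons, Sym2.eq_iff, mul_add]
  congr 1
  grind

theorem edgeDeg_cons {n : ℕ} (E : Multiset (Sym2 (Fin n))) (v w u : Fin n) :
    edgeDeg (s(v, w) ::ₘ E) u =
      edgeDeg E u + ((if u = v then 1 else 0) + (if u = w then 1 else 0)) := by
  simp only [edgeDeg, edgeAdj_cons, Finset.sum_add_distrib, ← Finset.mul_sum]
  simp

theorem edgeAdj_comm {n : ℕ} (E : Multiset (Sym2 (Fin n))) (u v : Fin n) :
    edgeAdj E u v = edgeAdj E v u := by
  simp only [edgeAdj, Sym2.eq_swap, eq_comm]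

theorem edgeAdj_map_castSucc {n : ℕ} (E : Multiset (Sym2 (Fin n))) (a b : Fin n) :
    edgeAdj (E.map (Sym2.map Fin.castSucc)) a.castSucc b.castSucc = edgeAdj E a b := by
  have h : s(a.castSucc, b.castSucc) = Sym2.map Fin.castSucc s(a, b) := rfl
  simp only [edgeAdj, Fin.castSucc_inj]
  rw [h, Multiset.count_map_eq_count' _ _ (Sym2.map.injective (Fin.castSucc_injective _))]

theorem edgeAdj_map_castSucc_last {n : ℕ} (E : Multiset (Sym2 (Fin n))) (a : Fin (n + 1)) :
    edgeAdj (E.map (Sym2.map Fin.castSucc)) a (Fin.last n) = 0 := by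
  simp only [edgeAdj, mul_eq_zero]
  right
  rw [Multiset.count_eq_zero, Multiset.mem_map]
  rintro ⟨e, -, he⟩
  induction e with
  | _ x y =>
    rw [Sym2.map_mk, Sym2.eq_iff] at he
    rcases he with ⟨-, h⟩ | ⟨h, -⟩
    · exact (Fin.castSucc_lt_last y).ne h
    · exact (Fin.castSucc_lt_last x).ne h

theorem edgeDeg_map_castSucc {n : ℕ} (E : Multiset (Sym2 (Fin n))) (a : Fin n) :
    edgeDeg (E.map (Sym2.map Fin.castSucc)) a.castSucc = edgeDeg E a := by
  rw [edgeDeg, Fin.sum_univ_castSucc, edgeAdj_map_castSucc_last, add_zero]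
  simp only [edgeAdj_map_castSucc, edgeDeg]

theorem edgeDeg_map_castSucc_last {n : ℕ} (E : Multiset (Sym2 (Fin n))) :
    edgeDeg (E.map (Sym2.map Fin.castSucc)) (Fin.last n) = 0 :=
  Finset.sum_eq_zero fun b _ => by rw [edgeAdj_comm, edgeAdj_map_castSucc_last]

namespace Multigraph

theorem adj_comm (g : Multigraph) (u v : Fin g.n) : g.adj u v = g.adj v u :=
  edgeAdj_comm _ _ _

theorem deg_addEdge (g : Multigraph) (v w u : Fin g.n) :
    (g.addEdge v w).deg u =
      g.deg u + ((if u = v then 1 else 0) + (if u = w then 1 else 0)) :=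
  edgeDeg_cons _ _ _ _

theorem deg_attach_castSucc (g : Multigraph) (v u : Fin g.n) :
    (g.attach v).deg (u.castSucc : Fin (g.n + 1)) = g.deg u + (if u = v then 1 else 0) := by
  refine (edgeDeg_cons (g.edges.map (Sym2.map Fin.castSucc)) v.castSucc (Fin.last g.n)
    u.castSucc).trans ?_
  rw [edgeDeg_map_castSucc]
  simp [(Fin.castSucc_lt_last u).ne, edgeDeg, deg, edgeAdj, adj]

theorem deg_attach_last (g : Multigraph) (v : Fin g.n) :
    (g.attach v).deg (Fin.last g.n : Fin (g.n + 1)) = 1 := by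
  refine (edgeDeg_cons (g.edges.map (Sym2.map Fin.castSucc)) v.castSucc (Fin.last g.n)
    (Fin.last g.n)).trans ?_
  rw [edgeDeg_map_castSucc_last]
  simp [(Fin.castSucc_lt_last v).ne']

theorem sum_deg_addEdge {R : Type*} [AddCommMonoid R] (g : Multigraph) (v w : Fin g.n)
    (F : ℕ → R) : ∑ u, F ((g.addEdge v w).deg u) =
      ∑ u, F (g.deg u + ((if u = v then 1 else 0) + (if u = w then 1 else 0))) :=
  Finset.sum_congr rfl fun u _ => congrArg F (deg_addEdge g v w u)

theorem sum_deg_attach {R : Type*} [AddCommMonoid R] (g : Multigraph) (v : Fin g.n)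
    (F : ℕ → R) : ∑ u, F ((g.attach v).deg u) =
      (∑ u, F (g.deg u + if u = v then 1 else 0)) + F 1 := by
  refine (Fin.sum_univ_castSucc (fun u : Fin (g.n + 1) => F ((g.attach v).deg u))).trans ?_
  exact congrArg₂ _ (Finset.sum_congr rfl fun u _ => congrArg F (deg_attach_castSucc g v u))
    (congrArg F (deg_attach_last g v))

/-- The properties shared by all graphs that the model can reach at time `t`. -/
structure Reachable (t : ℕ) (g : Multigraph) : Prop where
  card_edges : g.edges.card = t
  card_le : g.n ≤ t + 1
  deg_pos : ∀ v, 0 < g.deg v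
  sum_deg : ∑ v, g.deg v = 2 * t

theorem reachable_singleEdge : Reachable 1 singleEdge where
  card_edges := rfl
  card_le := le_rfl
  deg_pos := by decide
  sum_deg := by decide

theorem Reachable.addEdge {t : ℕ} {g : Multigraph} (hg : Reachable t g) (v w : Fin g.n) :
    Reachable (t + 1) (g.addEdge v w) where
  card_edges := by simp [Multigraph.addEdge, hg.card_edges]
  card_le := hg.card_le.trans (Nat.le_succ _)
  deg_pos u := (Nat.add_pos_left (hg.deg_pos u) _).trans_eq (deg_addEdge g v w u).symm
  sum_deg := by
    rw [sum_deg_addEdge g v w fun x => x]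
    simp only [Finset.sum_add_distrib, hg.sum_deg]
    simp
    ring

theorem Reachable.attach {t : ℕ} {g : Multigraph} (hg : Reachable t g) (v : Fin g.n) :
    Reachable (t + 1) (g.attach v) where
  card_edges := by simp [Multigraph.attach, hg.card_edges]
  card_le := Nat.succ_le_succ hg.card_le
  deg_pos := Fin.lastCases (one_pos.trans_eq (deg_attach_last g v).symm) fun u =>
    (Nat.add_pos_left (hg.deg_pos u) _).trans_eq (deg_attach_castSucc g v u).symm
  sum_deg := by
    rw [sum_deg_attach g v fun x => x]
    simp only [Finset.sum_add_distrib, hg.sum_deg]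
    simp
    ring

theorem degCount_eq_sum (g : Multigraph) (d : ℕ) :
    (g.degCount d : ℝ) = ∑ v, if g.deg v = d then 1 else 0 := by
  simp [degCount, degSet]

/-- Change of the number of vertices of degree `d` when the degree of `v` grows by one. -/
def incr (g : Multigraph) (d : ℕ) (v : Fin g.n) : ℝ :=
  (if g.deg v + 1 = d then 1 else 0) - (if g.deg v = d then 1 else 0)

/-- Correction to two changes `incr` when both ends of a new edge are at `v`. -/
def loopIncr (g : Multigraph) (d : ℕ) (v : Fin g.n) : ℝ :=
  (if g.deg v + 2 = d then 1 else 0) - 2 * (if g.deg v + 1 = d then 1 else 0) +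
    (if g.deg v = d then 1 else 0)

theorem degCount_attach (g : Multigraph) (d : ℕ) (v : Fin g.n) :
    ((g.attach v).degCount d : ℝ) - g.degCount d = (if d = 1 then 1 else 0) + g.incr d v := by
  rw [degCount_eq_sum, degCount_eq_sum, sum_deg_attach g v fun x => if x = d then (1 : ℝ) else 0,
    add_sub_right_comm, ← Finset.sum_sub_distrib, Finset.sum_eq_single v]
  · simp only [incr, if_true, eq_comm (a := 1)]
    ring
  · intro u _ hu
    simp [hu]
  · simp

/-- A loop raises one degree by two. Subtracting twice `incr` from the true change leaves the second
difference `loopIncr`. -/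
theorem degCount_addEdge (g : Multigraph) (d : ℕ) (v w : Fin g.n) :
    ((g.addEdge v w).degCount d : ℝ) - g.degCount d =
      g.incr d v + g.incr d w + if v = w then g.loopIncr d v else 0 := by
  rw [degCount_eq_sum, degCount_eq_sum,
    sum_deg_addEdge g v w fun x => if x = d then (1 : ℝ) else 0, ← Finset.sum_sub_distrib]
  have key : ∀ u : Fin g.n,
      (if g.deg u + ((if u = v then 1 else 0) + (if u = w then 1 else 0)) = d then (1 : ℝ) else 0) -
        (if g.deg u = d then 1 else 0) = (if u = v then g.incr d u else 0) +
        (if u = w then g.incr d u else 0) +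
          if u = v then (if v = w then g.loopIncr d v else 0) else 0 := by
    intro u
    by_cases h1 : u = v
    · subst h1
      by_cases h2 : u = w
      · simp only [h2, if_true, incr, loopIncr]
        ring
      · simp [h2, incr]
    · by_cases h2 : u = w
      · simp [h2, incr, show w ≠ v from h2 ▸ h1]
      · simp [h1, h2]
  simp only [key, Finset.sum_add_distrib]
  simp

theorem abs_incr_le (g : Multigraph) (d : ℕ) (v : Fin g.n) : |g.incr d v| ≤ 1 := by
  unfold incr
  split_ifs <;> norm_num

theorem abs_loopIncr_le (g : Multigraph) (d : ℕ) (v : Fin g.n) : |g.loopIncr d v| ≤ 2 := by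
  unfold loopIncr
  grind

theorem abs_degCount_attach_sub_le (g : Multigraph) (d : ℕ) (v : Fin g.n) :
    |((g.attach v).degCount d : ℝ) - g.degCount d| ≤ 4 := by
  rw [degCount_attach]
  have := abs_incr_le g d v
  refine (abs_add_le _ _).trans ?_
  split_ifs <;> norm_num <;> linarith

theorem abs_degCount_addEdge_sub_le (g : Multigraph) (d : ℕ) (v w : Fin g.n) :
    |((g.addEdge v w).degCount d : ℝ) - g.degCount d| ≤ 4 := by
  rw [degCount_addEdge]
  have h1 := abs_le.1 (abs_incr_le g d v)
  have h2 := abs_le.1 (abs_incr_le g d w)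
  have h3 := abs_le.1 (abs_loopIncr_le g d v)
  rw [abs_le]
  split_ifs <;> constructor <;> linarith

theorem degCount_le (g : Multigraph) (d : ℕ) : g.degCount d ≤ g.n := 
  (Finset.card_le_univ (g.degSet d)).trans_eq (Fintype.card_fin _)

end Multigraph

/-! ### Random walk and stationarity of the size-biased law. -/

theorem PMF.hasSum_toReal {ι : Type*} (P : PMF ι) : HasSum (fun k => (P k).toReal) 1 := by
  have h : ∑' k, P k ≠ ⊤ := by simp [P.tsum_coe]
  have := (ENNReal.summable_toReal h).hasSum
  rwa [← ENNReal.tsum_toReal_eq fun k => P.apply_ne_top k, P.tsum_coe, ENNReal.toReal_one] at this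

namespace Multigraph

variable {g : Multigraph}

theorem sum_adj (g : Multigraph) (u : Fin g.n) : ∑ v, (g.adj u v : ℝ) = g.deg u := by
  rw [deg, Nat.cast_sum]

theorem walkMatrix_pow_nonneg (g : Multigraph) (k : ℕ) (u v : Fin g.n) :
    0 ≤ (g.walkMatrix ^ k) u v := by
  induction k generalizing v with
  | zero =>
    rw [pow_zero, Matrix.one_apply]
    split_ifs <;> norm_num
  | succ k ih =>
    rw [pow_succ, Matrix.mul_apply]
    refine Finset.sum_nonneg fun w _ => mul_nonneg (ih w) ?_
    rw [walkMatrix, Matrix.of_apply]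
    positivity

theorem sum_walkMatrix_pow (hg : ∀ v, 0 < g.deg v) (k : ℕ) (u : Fin g.n) :
    ∑ v, (g.walkMatrix ^ k) u v = 1 := by
  induction k with
  | zero => simp [Matrix.one_apply]
  | succ k ih =>
    simp only [pow_succ, Matrix.mul_apply]
    rw [Finset.sum_comm, ← ih]
    refine Finset.sum_congr rfl fun w _ => ?_
    rw [← Finset.mul_sum]
    simp only [walkMatrix, Matrix.of_apply]
    rw [← Finset.sum_div, sum_adj, div_self (Nat.cast_ne_zero.2 (hg w).ne'), mul_one]

/-- Reversibility: deg v times the transition probability from v to u is `adj v u`, which is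
symmetric, so summing over v gives deg u. -/
theorem sum_deg_mul_walkMatrix_pow (hg : ∀ v, 0 < g.deg v) (k : ℕ) (w : Fin g.n) :
    ∑ v, (g.deg v : ℝ) * (g.walkMatrix ^ k) v w = g.deg w := by
  induction k with
  | zero => simp [Matrix.one_apply]
  | succ k ih =>
    simp only [pow_succ', Matrix.mul_apply, Finset.mul_sum]
    rw [Finset.sum_comm, ← ih]
    refine Finset.sum_congr rfl fun u _ => ?_
    simp only [← mul_assoc]
    rw [← Finset.sum_mul, ← sum_adj]
    refine congrArg (· * _) (Finset.sum_congr rfl fun v _ => ?_)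
    rw [walkMatrix, Matrix.of_apply, mul_div_cancel₀ _ (Nat.cast_ne_zero.2 (hg v).ne'), adj_comm]

theorem walkMatrix_pow_le_one (hg : ∀ v, 0 < g.deg v) (k : ℕ) (u v : Fin g.n) :
    (g.walkMatrix ^ k) u v ≤ 1 := by
  rw [← sum_walkMatrix_pow hg k u]
  exact Finset.single_le_sum (fun w _ => walkMatrix_pow_nonneg g k u w) (Finset.mem_univ v)

theorem hasSum_walkProb (hg : ∀ v, 0 < g.deg v) (P : PMF ℕ) (u v : Fin g.n) :
    HasSum (fun k => (P k).toReal * (g.walkMatrix ^ k) u v) (g.walkProb P u v) := by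
  refine (Summable.of_nonneg_of_le (fun k => ?_) (fun k => ?_) P.hasSum_toReal.summable).hasSum
  · exact mul_nonneg ENNReal.toReal_nonneg (walkMatrix_pow_nonneg g k u v)
  · exact mul_le_of_le_one_right ENNReal.toReal_nonneg (walkMatrix_pow_le_one hg k u v)

theorem walkProb_nonneg (g : Multigraph) (P : PMF ℕ) (u v : Fin g.n) : 0 ≤ g.walkProb P u v :=
  tsum_nonneg fun k => mul_nonneg ENNReal.toReal_nonneg (walkMatrix_pow_nonneg g k u v)

theorem sum_walkProb (hg : ∀ v, 0 < g.deg v) (P : PMF ℕ) (u : Fin g.n) :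
    ∑ v, g.walkProb P u v = 1 := by
  refine (hasSum_sum fun v _ => hasSum_walkProb hg P u v).unique ?_
  simpa only [← Finset.mul_sum, sum_walkMatrix_pow hg, mul_one] using P.hasSum_toReal

theorem walkProb_le_one (hg : ∀ v, 0 < g.deg v) (P : PMF ℕ) (u v : Fin g.n) :
    g.walkProb P u v ≤ 1 := by
  rw [← sum_walkProb hg P u]
  exact Finset.single_le_sum (fun w _ => walkProb_nonneg g P u w) (Finset.mem_univ v)

theorem sum_deg_mul_walkProb (hg : ∀ v, 0 < g.deg v) (P : PMF ℕ) (w : Fin g.n) :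
    ∑ v, (g.deg v : ℝ) * g.walkProb P v w = g.deg w := by
  refine (hasSum_sum fun v _ => (hasSum_walkProb hg P v w).mul_left (g.deg v : ℝ)).unique ?_
  simp only [mul_left_comm (g.deg _ : ℝ), ← Finset.mul_sum, sum_deg_mul_walkMatrix_pow hg]
  simpa using P.hasSum_toReal.mul_right (g.deg w : ℝ)

theorem sum_sizeBiased_mul_walkProb (hg : ∀ v, 0 < g.deg v) (P : PMF ℕ) (w : Fin g.n) :
    ∑ v, g.sizeBiased v * g.walkProb P v w = g.sizeBiased w := by
  simp only [sizeBiased, div_mul_eq_mul_div]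
  rw [← Finset.sum_div, sum_deg_mul_walkProb hg]

theorem Reachable.sizeBiased_eq {t : ℕ} (hg : Reachable t g) (v : Fin g.n) :
    g.sizeBiased v = g.deg v / (2 * t) := by
  rw [sizeBiased, ← Nat.cast_sum, hg.sum_deg]
  simp

theorem sizeBiased_nonneg (g : Multigraph) (v : Fin g.n) : 0 ≤ g.sizeBiased v := by
  unfold sizeBiased
  positivity

theorem Reachable.sum_sizeBiased {t : ℕ} (hg : Reachable t g) (ht : 1 ≤ t) :
    ∑ v, g.sizeBiased v = 1 := by
  simp only [hg.sizeBiased_eq]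
  rw [← Finset.sum_div, ← Nat.cast_sum, hg.sum_deg]
  push_cast
  exact div_self (by positivity)

/-! ### Conditional drift of the degree counts. -/

/-- Conditional mean of `Φ` at the next graph, given that the present one is `g`. -/
noncomputable def stepMean (α : ℝ) (P : PMF ℕ) (g : Multigraph) (Φ : Multigraph → ℝ) : ℝ :=
  ∑ v, g.sizeBiased v *
    (α * Φ (g.attach v) + (1 - α) * ∑ w, g.walkProb P v w * Φ (g.addEdge v w))

theorem stepMean_const_mul (α : ℝ) (P : PMF ℕ) (g : Multigraph) (c : ℝ) (Φ : Multigraph → ℝ) :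
    stepMean α P g (fun h => c * Φ h) = c * stepMean α P g Φ := by
  simp only [stepMean, Finset.mul_sum]
  refine Finset.sum_congr rfl fun v _ => ?_
  rw [mul_left_comm c, mul_add c, mul_left_comm c α, Finset.mul_sum]
  congr 2
  exact Finset.sum_congr rfl fun w _ => by ring

theorem Reachable.stepMean_sub_const {t : ℕ} (hg : Reachable t g) (ht : 1 ≤ t) (α : ℝ)
    (P : PMF ℕ) (Φ : Multigraph → ℝ) (c : ℝ) :
    stepMean α P g (fun h => Φ h - c) = stepMean α P g Φ - c := by
  have hc : ∑ v, g.sizeBiased v * c = c := by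
    rw [← Finset.sum_mul, hg.sum_sizeBiased ht, one_mul]
  conv_rhs => rw [← hc, stepMean, ← Finset.sum_sub_distrib]
  refine Finset.sum_congr rfl fun v _ => ?_
  simp only [mul_sub (walkProb _ _ _ _), Finset.sum_sub_distrib, ← Finset.sum_mul,
    sum_walkProb hg.deg_pos]
  ring

/-- Probability that a stationary walk of random length starts at a vertex of degree `d` and ends
where it started. -/
noncomputable def returnMass (P : PMF ℕ) (d : ℕ) (g : Multigraph) : ℝ :=
  ∑ v, g.sizeBiased v * g.walkProb P v v * if g.deg v = d then 1 else 0

theorem returnMass_nonneg (P : PMF ℕ) (d : ℕ) (g : Multigraph) : 0 ≤ returnMass P d g := by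
  refine Finset.sum_nonneg fun v _ => mul_nonneg
    (mul_nonneg (sizeBiased_nonneg g v) (walkProb_nonneg g P v v)) ?_
  split_ifs <;> norm_num

theorem Reachable.returnMass_zero {t : ℕ} (hg : Reachable t g) (P : PMF ℕ) :
    returnMass P 0 g = 0 :=
  Finset.sum_eq_zero fun v _ => by simp [(hg.deg_pos v).ne']

theorem Reachable.degCount_mul_le {t : ℕ} (hg : Reachable t g) (d : ℕ) :
    g.degCount d * d ≤ 2 * t := by
  rw [← hg.sum_deg, degCount, ← smul_eq_mul, ← Finset.sum_const]
  calc ∑ _v ∈ g.degSet d, d = ∑ v ∈ g.degSet d, g.deg v :=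
        Finset.sum_congr rfl fun v hv => ((Finset.mem_filter.1 hv).2).symm
    _ ≤ ∑ v, g.deg v := Finset.sum_le_univ_sum_of_nonneg fun _ => Nat.zero_le _

theorem avgReturn_nonneg (P : PMF ℕ) (d : ℕ) (g : Multigraph) : 0 ≤ g.avgReturn P d :=
  div_nonneg (Finset.sum_nonneg fun v _ => walkProb_nonneg g P v v) (Nat.cast_nonneg _)

theorem avgReturn_le_one (hg : ∀ v, 0 < g.deg v) (P : PMF ℕ) (d : ℕ) :
    g.avgReturn P d ≤ 1 := by
  refine div_le_one_of_le₀ ?_ (Nat.cast_nonneg _)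
  refine (Finset.sum_le_card_nsmul _ _ 1 fun v _ => walkProb_le_one hg P v v).trans_eq ?_
  simp [degCount]

/-- The left side is d·m_d/(2t) times the average, and vertices of degree d carry at most all 2t
edge ends. -/
theorem Reachable.returnMass_le_avgReturn {t : ℕ} (hg : Reachable t g) (ht : 1 ≤ t) (P : PMF ℕ)
    (d : ℕ) : returnMass P d g ≤ g.avgReturn P d := by
  have ht' : (0 : ℝ) < 2 * t := by positivity
  have h1 : returnMass P d g = d / (2 * t) * ∑ v ∈ g.degSet d, g.walkProb P v v := by
    rw [returnMass, degSet, Finset.sum_filter, Finset.mul_sum]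
    refine Finset.sum_congr rfl fun v _ => ?_
    split_ifs with h
    · rw [hg.sizeBiased_eq, h, mul_one]
    · simp
  have h2 : 0 ≤ ∑ v ∈ g.degSet d, g.walkProb P v v :=
    Finset.sum_nonneg fun v _ => walkProb_nonneg g P v v
  rw [h1]
  rcases Nat.eq_zero_or_pos (g.degCount d) with h0 | h0
  · rw [Finset.card_eq_zero.1 h0]
    simpa using avgReturn_nonneg P d g
  · rw [avgReturn, div_mul_eq_mul_div, div_le_div_iff₀ ht' (by exact_mod_cast h0), mul_comm (d : ℝ),
      mul_assoc]
    refine mul_le_mul_of_nonneg_left ?_ h2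
    rw [mul_comm]
    exact_mod_cast hg.degCount_mul_le d

/-- Mean effect of self-loops on the number of vertices of degree `d`. -/
noncomputable def loopError (P : PMF ℕ) (d : ℕ) (g : Multigraph) : ℝ :=
  ∑ v, g.sizeBiased v * g.walkProb P v v * g.loopIncr d v

/-- `loopIncr` is supported on degrees d − 2, d − 1 and d. Where the subtraction truncates, the
bound only gains nonnegative terms. -/
theorem Reachable.abs_loopError_le {t : ℕ} (hg : Reachable t g) (P : PMF ℕ) (d : ℕ) :
    |loopError P d g| ≤ returnMass P (d - 2) g + 2 * returnMass P (d - 1) g + returnMass P d g := by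
  refine (Finset.abs_sum_le_sum_abs _ _).trans ?_
  simp only [returnMass]
  rw [Finset.mul_sum, ← Finset.sum_add_distrib, ← Finset.sum_add_distrib]
  refine Finset.sum_le_sum fun v _ => ?_
  have h := mul_nonneg (sizeBiased_nonneg g v) (walkProb_nonneg g P v v)
  rw [abs_mul, abs_of_nonneg h, mul_left_comm 2, ← mul_add, ← mul_add]
  refine mul_le_mul_of_nonneg_left ?_ h
  have := hg.deg_pos v
  unfold loopIncr
  rw [abs_le]
  have e2 : g.deg v + 2 = d → g.deg v = d - 2 := by omega
  have e1 : g.deg v + 1 = d → g.deg v = d - 1 := by omega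
  split_ifs <;> norm_num <;> tauto

theorem Reachable.sum_sizeBiased_mul_ite {t : ℕ} (hg : Reachable t g) (d : ℕ) :
    ∑ v, g.sizeBiased v * (if g.deg v = d then 1 else 0) = d * g.degCount d / (2 * t) := by
  rw [degCount_eq_sum, Finset.mul_sum, Finset.sum_div]
  refine Finset.sum_congr rfl fun v _ => ?_
  split_ifs with h
  · rw [hg.sizeBiased_eq, h, mul_one, mul_one]
  · simp

theorem Reachable.sum_sizeBiased_mul_incr {t : ℕ} (hg : Reachable t g) {d : ℕ} (hd : 1 ≤ d) :
    ∑ v, g.sizeBiased v * g.incr d v =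
      (((d : ℝ) - 1) * g.degCount (d - 1) - d * g.degCount d) / (2 * t) := by
  obtain ⟨d, rfl⟩ := Nat.exists_eq_add_of_le' hd
  simp only [incr, mul_sub, Finset.sum_sub_distrib, Nat.add_right_cancel_iff,
    hg.sum_sizeBiased_mul_ite]
  push_cast [Nat.add_sub_cancel]
  ring

theorem Reachable.stepMean_degCount {t : ℕ} (hg : Reachable t g) (ht : 1 ≤ t) (α : ℝ) (P : PMF ℕ)
    {d : ℕ} (hd : 1 ≤ d) :
    stepMean α P g (fun h => (h.degCount d : ℝ) - g.degCount d) =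
      α * (if d = 1 then 1 else 0) +
        (2 - α) * ((((d : ℝ) - 1) * g.degCount (d - 1) - d * g.degCount d) / (2 * t)) +
          (1 - α) * loopError P d g := by
  rw [← hg.sum_sizeBiased_mul_incr hd]
  -- By stationarity, both ends of the new edge contribute the same mean increment.
  have h1 : ∑ v, g.sizeBiased v * ∑ w, g.walkProb P v w * g.incr d w =
      ∑ v, g.sizeBiased v * g.incr d v := by
    simp only [Finset.mul_sum, ← mul_assoc]
    rw [Finset.sum_comm]
    simp only [← Finset.sum_mul, sum_sizeBiased_mul_walkProb hg.deg_pos]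
  have h2 : ∀ v, ∑ w, g.walkProb P v w * ((g.addEdge v w).degCount d - g.degCount d : ℝ) =
      g.incr d v + ∑ w, g.walkProb P v w * g.incr d w + g.walkProb P v v * g.loopIncr d v := by
    intro v
    simp only [degCount_addEdge, mul_add, Finset.sum_add_distrib, ← Finset.sum_mul,
      sum_walkProb hg.deg_pos]
    simp
  calc stepMean α P g (fun h => (h.degCount d : ℝ) - g.degCount d)
      = ∑ v, (α * (if d = 1 then 1 else 0) * g.sizeBiased v + g.sizeBiased v * g.incr d v +
          (1 - α) * (g.sizeBiased v * ∑ w, g.walkProb P v w * g.incr d w) +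
          (1 - α) * (g.sizeBiased v * g.walkProb P v v * g.loopIncr d v)) := by
        refine Finset.sum_congr rfl fun v _ => ?_
        simp only [h2, degCount_attach]
        ring
    _ = _ := by
        simp only [Finset.sum_add_distrib, ← Finset.mul_sum, h1, hg.sum_sizeBiased ht, loopError]
        ring

end Multigraph

/-! ### Finite range at each time and the Markov property. -/

open Classical in
theorem comp_ae_eq_sum_indicator {Ω S : Type*} [MeasurableSpace Ω] {μ : Measure Ω}
    {X : Ω → S} {R : Finset S} (hR : ∀ᵐ ω ∂μ, X ω ∈ R) (F : S → ℝ) :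
    (fun ω => F (X ω)) =ᵐ[μ] fun ω => ∑ x ∈ R, (X ⁻¹' {x}).indicator (fun _ => F x) ω := by
  filter_upwards [hR] with ω hω
  simp only [Set.indicator_apply, Set.mem_preimage, Set.mem_singleton_iff]
  rw [Finset.sum_ite_eq, if_pos hω]

section FiniteRange

variable {Ω S : Type*} [MeasurableSpace Ω] {μ : Measure Ω} [IsFiniteMeasure μ]
  [MeasurableSpace S] [MeasurableSingletonClass S]

theorem integrable_comp_of_ae_mem_finset {X : Ω → S} (hX : Measurable X) {R : Finset S}
    (hR : ∀ᵐ ω ∂μ, X ω ∈ R) (F : S → ℝ) : Integrable (fun ω => F (X ω)) μ := by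
  refine Integrable.congr ?_ (comp_ae_eq_sum_indicator hR F).symm
  exact integrable_finsetSum _ fun x _ =>
    (integrable_const _).indicator (hX (measurableSet_singleton x))

theorem integral_comp_eq_sum {X : Ω → S} (hX : Measurable X) {R : Finset S}
    (hR : ∀ᵐ ω ∂μ, X ω ∈ R) (F : S → ℝ) :
    ∫ ω, F (X ω) ∂μ = ∑ x ∈ R, μ.real (X ⁻¹' {x}) * F x := by
  rw [integral_congr_ae (comp_ae_eq_sum_indicator hR F), integral_finsetSum]
  · refine Finset.sum_congr rfl fun x _ => ?_
    rw [integral_indicator_const _ (hX (measurableSet_singleton x)), smul_eq_mul]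
  · exact fun x _ => (integrable_const _).indicator (hX (measurableSet_singleton x))

theorem hasSum_measureReal_inter_preimage [Countable S] {X : Ω → S} (hX : Measurable X)
    (A : Set Ω) : HasSum (fun x => μ.real (A ∩ X ⁻¹' {x})) (μ.real A) := by
  have h : ∑' x, μ (A ∩ X ⁻¹' {x}) = μ A := by
    have h1 := tsum_measure_preimage_singleton (μ := μ.restrict A) (f := X) (Set.countable_univ)
      fun y _ => hX (measurableSet_singleton y)
    rw [tsum_univ fun x => (μ.restrict A) (X ⁻¹' {x})] at h1
    simpa [Measure.restrict_apply (hX (measurableSet_singleton _)), Set.inter_comm] using h1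
  have h2 := ENNReal.hasSum_toReal (f := fun x => μ (A ∩ X ⁻¹' {x}))
    (by rw [h]; exact measure_ne_top μ A)
  rwa [← ENNReal.tsum_toReal_eq fun x => measure_ne_top _ _, h] at h2

end FiniteRange

namespace Multigraph

instance : Countable Multigraph := by
  refine Function.Injective.countable
    (f := fun g : Multigraph => (⟨g.n, g.edges⟩ : Σ n, Multiset (Sym2 (Fin n)))) ?_
  rintro ⟨n, E⟩ ⟨n', E'⟩ h
  cases h
  rfl

instance : DiscreteMeasurableSpace Multigraph := ⟨fun _ => trivial⟩

/-- Thus every real function of G_t is almost surely simple, hence integrable, and its mean is a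
finite sum. -/
theorem finite_setOf_reachable (t : ℕ) : {g | Reachable t g}.Finite := by
  refine (Set.finite_range fun p : Σ n : Fin (t + 2), Sym (Sym2 (Fin n)) t =>
    (⟨p.1, p.2.1⟩ : Multigraph)).subset fun g hg => ?_
  exact ⟨⟨⟨g.n, Nat.lt_succ_of_le hg.card_le⟩, ⟨g.edges, hg.card_edges⟩⟩, rfl⟩

/-- The finite set of graphs that can be reached at time `t`. -/
noncomputable def reachableFinset (t : ℕ) : Finset Multigraph := (finite_setOf_reachable t).toFinset

theorem mem_reachableFinset {t : ℕ} {g : Multigraph} : g ∈ reachableFinset t ↔ Reachable t g := by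
  simp [reachableFinset]

theorem exists_of_stepProb_ne_zero {α : ℝ} {P : PMF ℕ} {g h : Multigraph}
    (hp : stepProb α P g h ≠ 0) : (∃ v, h = g.attach v) ∨ ∃ v w, h = g.addEdge v w := by
  contrapose! hp
  refine Finset.sum_eq_zero fun v _ => ?_
  simp [hp.1 v, hp.2 v]

theorem sum_stepProb_mul {α : ℝ} {P : PMF ℕ} {g : Multigraph} {R : Finset Multigraph}
    (h1 : ∀ v, g.attach v ∈ R) (h2 : ∀ v w, g.addEdge v w ∈ R) (Φ : Multigraph → ℝ) :
    ∑ h ∈ R, stepProb α P g h * Φ h = stepMean α P g Φ := by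
  classical
  simp only [stepProb, stepMean, Finset.sum_mul]
  rw [Finset.sum_comm]
  refine Finset.sum_congr rfl fun v _ => ?_
  simp only [mul_assoc, add_mul, ← Finset.mul_sum, Finset.sum_add_distrib, Finset.sum_mul]
  rw [Finset.sum_comm (s := R)]
  simp only [← Finset.mul_sum, ite_mul, one_mul, zero_mul, Finset.sum_ite_eq', h1, h2, if_true]

end Multigraph

namespace IsRWSB

open Multigraph

theorem measurable_pair {Ω : Type*} [MeasurableSpace Ω] {μ : Measure Ω} {α : ℝ} {P : PMF ℕ}
    {G : ℕ → Ω → Multigraph} (hG : IsRWSB μ α P G) {t : ℕ} (ht : 1 ≤ t) :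
    Measurable fun ω => (G t ω, G (t + 1) ω) :=
  (hG.measurable t ht).prodMk (hG.measurable (t + 1) (Nat.le_add_left 1 t))

variable {Ω : Type*} [MeasurableSpace Ω] {μ : Measure Ω} [IsProbabilityMeasure μ]
  {α : ℝ} {P : PMF ℕ} {G : ℕ → Ω → Multigraph}

/-- `law` prescribes only probabilities of whole paths. Splitting over the countably many histories
up to time t, each piece gains exactly the factor `stepProb α P g h`. -/
theorem measureReal_pair (hG : IsRWSB μ α P G) {t : ℕ} (ht : 1 ≤ t) (g h : Multigraph) :
    μ.real {ω | G t ω = g ∧ G (t + 1) ω = h} =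
      μ.real {ω | G t ω = g} * stepProb α P g h := by
  let X : Ω → (Finset.Icc 1 t → Multigraph) := fun ω s => G s ω
  have hX : Measurable X :=
    measurable_pi_iff.2 fun s => hG.measurable s (Finset.mem_Icc.1 s.2).1
  suffices key : ∀ x, μ.real ({ω | G t ω = g ∧ G (t + 1) ω = h} ∩ X ⁻¹' {x}) =
      μ.real ({ω | G t ω = g} ∩ X ⁻¹' {x}) * stepProb α P g h by
    refine (hasSum_measureReal_inter_preimage hX _).unique ?_
    rw [funext key]
    exact (hasSum_measureReal_inter_preimage hX _).mul_right _
  intro x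
  have htt : t ∈ Finset.Icc 1 t := Finset.mem_Icc.2 ⟨ht, le_rfl⟩
  by_cases hx : x ⟨t, htt⟩ = g
  -- The history x continued by h, so that `law` at t and at t + 1 is read on one path.
  · let p : ℕ → Multigraph := fun s => if hs : s ∈ Finset.Icc 1 t then x ⟨s, hs⟩ else h
    have hp : ∀ s (hs : s ∈ Finset.Icc 1 t), p s = x ⟨s, hs⟩ := fun s hs => dif_pos hs
    have hpt : p t = g := (hp t htt).trans hx
    have hpt' : p (t + 1) = h := dif_neg (by simp)
    have hXx : ∀ ω, X ω = x ↔ ∀ s ∈ Finset.Icc 1 t, G s ω = p s := by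
      intro ω
      rw [funext_iff]
      exact ⟨fun H s hs => (H ⟨s, hs⟩).trans (hp s hs).symm,
        fun H s => (H s s.2).trans (hp s s.2)⟩
    have e1 : {ω | G t ω = g} ∩ X ⁻¹' {x} = {ω | ∀ s ∈ Finset.Icc 1 t, G s ω = p s} := by
      ext ω
      simp only [Set.mem_inter_iff, Set.mem_ofPred_eq, Set.mem_preimage, Set.mem_singleton_iff, hXx]
      exact ⟨fun H => H.2, fun H => ⟨(H t htt).trans hpt, H⟩⟩
    have e2 : {ω | G t ω = g ∧ G (t + 1) ω = h} ∩ X ⁻¹' {x} =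
        {ω | ∀ s ∈ Finset.Icc 1 (t + 1), G s ω = p s} := by
      ext ω
      simp only [Set.mem_inter_iff, Set.mem_ofPred_eq, Set.mem_preimage, Set.mem_singleton_iff, hXx]
      constructor
      · rintro ⟨⟨-, H1⟩, H2⟩ s hs
        rcases Nat.le_or_eq_of_le_succ (Finset.mem_Icc.1 hs).2 with h' | h'
        · exact H2 s (Finset.mem_Icc.2 ⟨(Finset.mem_Icc.1 hs).1, h'⟩)
        · rw [h', hpt', H1]
      · intro H
        have H' : ∀ s ∈ Finset.Icc 1 t, G s ω = p s := fun s hs =>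
          H s (Finset.Icc_subset_Icc_right (Nat.le_succ t) hs)
        exact ⟨⟨(H' t htt).trans hpt, (H (t + 1) (by simp)).trans hpt'⟩, H'⟩
    rw [e1, e2, hG.law t ht, hG.law (t + 1) (Nat.le_add_left _ _), Finset.prod_Ico_succ_top ht,
      hpt, hpt', mul_assoc]
  · have e : ∀ ω, X ω = x → G t ω ≠ g := by
      rintro ω rfl
      exact hx
    have e1 : {ω | G t ω = g} ∩ X ⁻¹' {x} = ∅ :=
      Set.eq_empty_of_forall_notMem fun ω hω => e ω hω.2 hω.1
    have e2 : {ω | G t ω = g ∧ G (t + 1) ω = h} ∩ X ⁻¹' {x} = ∅ :=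
      Set.eq_empty_of_forall_notMem fun ω hω => e ω hω.2 hω.1.1
    rw [e1, e2, measureReal_empty, zero_mul]

/-- There are countably many pairs of graphs, so the null events of the forbidden transitions can be
united. -/
theorem ae_stepProb_ne_zero (hG : IsRWSB μ α P G) {t : ℕ} (ht : 1 ≤ t) :
    ∀ᵐ ω ∂μ, stepProb α P (G t ω) (G (t + 1) ω) ≠ 0 := by
  have h : ∀ g h, stepProb α P g h = 0 → ∀ᵐ ω ∂μ, ¬(G t ω = g ∧ G (t + 1) ω = h) := by
    intro g h h0
    have := hG.measureReal_pair ht g h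
    rw [h0, mul_zero, measureReal_eq_zero_iff] at this
    exact measure_eq_zero_iff_ae_notMem.1 this
  have h' : ∀ᵐ ω ∂μ, ∀ g h, stepProb α P g h = 0 → ¬(G t ω = g ∧ G (t + 1) ω = h) := by
    simp only [ae_all_iff]
    exact h
  filter_upwards [h'] with ω hω h0 using hω _ _ h0 ⟨rfl, rfl⟩

theorem ae_reachable (hG : IsRWSB μ α P G) {t : ℕ} (ht : 1 ≤ t) :
    ∀ᵐ ω ∂μ, Reachable t (G t ω) := by
  induction t, ht using Nat.le_induction with
  | base =>
    have h : ∀ᵐ ω ∂μ, ∀ g, g ≠ singleEdge → G 1 ω ≠ g := by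
      simp only [ae_all_iff]
      intro g hg
      have := hG.law 1 le_rfl fun _ => g
      rw [if_neg hg, zero_mul, measureReal_eq_zero_iff] at this
      simpa using measure_eq_zero_iff_ae_notMem.1 this
    filter_upwards [h] with ω hω
    have : G 1 ω = singleEdge := not_not.1 fun h' => hω _ h' rfl
    exact this ▸ reachable_singleEdge
  | succ t ht ih =>
    filter_upwards [ih, hG.ae_stepProb_ne_zero ht] with ω h1 h2
    rcases exists_of_stepProb_ne_zero h2 with ⟨v, hv⟩ | ⟨v, w, hv⟩
    · exact hv ▸ h1.attach v
    · exact hv ▸ h1.addEdge v w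

theorem ae_abs_degCount_sub_le (hG : IsRWSB μ α P G) {t : ℕ} (ht : 1 ≤ t) (d : ℕ) :
    ∀ᵐ ω ∂μ, |((G (t + 1) ω).degCount d : ℝ) - (G t ω).degCount d| ≤ 4 := by
  filter_upwards [hG.ae_stepProb_ne_zero ht] with ω h
  rcases exists_of_stepProb_ne_zero h with ⟨v, hv⟩ | ⟨v, w, hv⟩
  · exact hv ▸ abs_degCount_attach_sub_le _ d v
  · exact hv ▸ abs_degCount_addEdge_sub_le _ d v w

theorem integrable_comp (hG : IsRWSB μ α P G) {t : ℕ} (ht : 1 ≤ t) (F : Multigraph → ℝ) :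
    Integrable (fun ω => F (G t ω)) μ :=
  integrable_comp_of_ae_mem_finset (hG.measurable t ht)
    ((hG.ae_reachable ht).mono fun _ => mem_reachableFinset.2) F

theorem ae_pair_mem (hG : IsRWSB μ α P G) {t : ℕ} (ht : 1 ≤ t) :
    ∀ᵐ ω ∂μ, (G t ω, G (t + 1) ω) ∈ reachableFinset t ×ˢ reachableFinset (t + 1) := by
  filter_upwards [hG.ae_reachable ht, hG.ae_reachable (Nat.le_add_left 1 t)] with ω h1 h2
  exact Finset.mem_product.2 ⟨mem_reachableFinset.2 h1, mem_reachableFinset.2 h2⟩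

theorem integrable_comp_pair (hG : IsRWSB μ α P G) {t : ℕ} (ht : 1 ≤ t)
    (Φ : Multigraph → Multigraph → ℝ) : Integrable (fun ω => Φ (G t ω) (G (t + 1) ω)) μ :=
  integrable_comp_of_ae_mem_finset (hG.measurable_pair ht) (hG.ae_pair_mem ht) fun p => Φ p.1 p.2

/-- Markov property: integrate out the last graph. -/
theorem integral_comp_pair (hG : IsRWSB μ α P G) {t : ℕ} (ht : 1 ≤ t)
    (Φ : Multigraph → Multigraph → ℝ) :
    ∫ ω, Φ (G t ω) (G (t + 1) ω) ∂μ = ∫ ω, stepMean α P (G t ω) (Φ (G t ω)) ∂μ := by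
  rw [integral_comp_eq_sum (hG.measurable_pair ht) (hG.ae_pair_mem ht) fun p => Φ p.1 p.2,
    integral_comp_eq_sum (hG.measurable t ht)
      ((hG.ae_reachable ht).mono fun _ => mem_reachableFinset.2)
      fun g => stepMean α P g (Φ g), Finset.sum_product]
  refine Finset.sum_congr rfl fun g hg => ?_
  have hg' := mem_reachableFinset.1 hg
  rw [← sum_stepProb_mul (fun v => mem_reachableFinset.2 (hg'.attach v))
    fun v w => mem_reachableFinset.2 (hg'.addEdge v w), Finset.mul_sum]
  refine Finset.sum_congr rfl fun h _ => ?_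
  rw [← mul_assoc]
  refine congrArg (· * _) (Eq.trans ?_ (hG.measureReal_pair ht g h))
  refine congrArg μ.real (Set.ext fun ω => ?_)
  simp

end IsRWSB

/-! ### The Yule–Simon weights. -/

theorem Real.Gamma_natCast_succ_add_one_add {ρ : ℝ} (hρ : 0 < ρ) (k : ℕ) :
    Real.Gamma (((k + 1 : ℕ) : ℝ) + 1 + ρ) = (ρ + (k + 1 : ℕ)) * Real.Gamma (k + 1 + ρ) := by
  have h := Real.Gamma_add_one (s := k + 1 + ρ) (by positivity)
  push_cast
  rw [show (k : ℝ) + 1 + 1 + ρ = k + 1 + ρ + 1 by ring, h]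
  ring

theorem yuleSimon_recurrence {ρ : ℝ} (hρ : 0 < ρ) {d : ℕ} (hd : 1 ≤ d) :
    (ρ + d) * yuleSimon ρ d =
      ρ * (if d = 1 then 1 else 0) + ((d : ℝ) - 1) * yuleSimon ρ (d - 1) := by
  obtain ⟨k, rfl⟩ := Nat.exists_eq_add_of_le' hd
  have h1 := Real.Gamma_natCast_succ_add_one_add hρ k
  have h2 : Real.Gamma (k + 1 + ρ) ≠ 0 := (Real.Gamma_pos_of_pos (by positivity)).ne'
  have h3 : ρ + ((k + 1 : ℕ) : ℝ) ≠ 0 := by positivity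
  rcases Nat.eq_zero_or_pos k with rfl | hk
  · simp only [yuleSimon, h1]
    push_cast at *
    simp only [zero_add] at *
    field_simp
    simp
  · have hk' : (0 : ℝ) < k := by exact_mod_cast hk
    rw [if_neg (by omega), Nat.add_sub_cancel]
    simp only [yuleSimon, h1]
    push_cast at *
    rw [Real.Gamma_add_one hk'.ne']
    field_simp
    ring

/-- For d ≥ 1 the quotient of the two sides equals `Real.GammaSeq ρ d / Real.Gamma ρ`, once Γ(d + 1
+ ρ) is expanded as a product. -/
theorem yuleSimon_isEquivalent {ρ : ℝ} (hρ : 0 < ρ) :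
    (fun d : ℕ => yuleSimon ρ d) ~[atTop]
      (fun d : ℕ => ρ * Real.Gamma (1 + ρ) * (d : ℝ) ^ (-(1 + ρ))) := by
  have hprod : ∀ n : ℕ, Real.Gamma (n + 1 + ρ) =
      (∏ j ∈ Finset.range (n + 1), (ρ + j)) * Real.Gamma ρ := by
    intro n
    induction n with
    | zero => simp [add_comm 1 ρ, Real.Gamma_add_one hρ.ne']
    | succ n ih =>
      rw [Finset.prod_range_succ, mul_right_comm, ← ih, mul_comm,
        Real.Gamma_natCast_succ_add_one_add hρ]
  have hG : Real.Gamma ρ ≠ 0 := (Real.Gamma_pos_of_pos hρ).ne'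
  have hlim : Tendsto (fun n => Real.GammaSeq ρ n / Real.Gamma ρ) atTop (𝓝 1) := by
    simpa [div_self hG] using (Real.GammaSeq_tendsto_Gamma ρ).div_const (Real.Gamma ρ)
  refine Asymptotics.isEquivalent_of_tendsto_one (hlim.congr' ?_)
  filter_upwards [eventually_ge_atTop 1] with d hd
  obtain ⟨k, rfl⟩ := Nat.exists_eq_add_of_le' hd
  have hk : (0 : ℝ) < ((k + 1 : ℕ) : ℝ) := by positivity
  have hp : (∏ j ∈ Finset.range (k + 1 + 1), (ρ + j)) ≠ 0 :=
    Finset.prod_ne_zero_iff.2 fun j _ => by positivity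
  have hG' : Real.Gamma (1 + ρ) ≠ 0 := (Real.Gamma_pos_of_pos (by positivity)).ne'
  have hpow : ((k + 1 : ℕ) : ℝ) ^ (-(1 + ρ)) =
      (((k + 1 : ℕ) : ℝ) * ((k + 1 : ℕ) : ℝ) ^ ρ)⁻¹ := by
    rw [Real.rpow_neg hk.le, Real.rpow_add hk, Real.rpow_one]
  have hpow' : ((k + 1 : ℕ) : ℝ) ^ ρ ≠ 0 := (Real.rpow_pos_of_pos hk ρ).ne'
  have hfact : (((k + 1).factorial : ℕ) : ℝ) = ((k + 1 : ℕ) : ℝ) * Real.Gamma ((k + 1 : ℕ) : ℝ) := by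
    rw [Nat.cast_add_one, Real.Gamma_nat_eq_factorial, Nat.factorial_succ]
    push_cast; ring
  simp only [Pi.div_apply, Real.GammaSeq, yuleSimon, hprod, hpow, hfact]
  have hk' := hk.ne'
  field_simp

/-! ### Growth of sequences, and modes of convergence. -/

/-- A sequence whose increments are small compared to `t` grows more slowly than `t ^ 2`. -/
theorem tendsto_div_sq_of_le_add {u θ : ℕ → ℝ} (hu : ∀ t, 0 ≤ u t)
    (hθ : Tendsto θ atTop (𝓝 0)) (h : ∀ t, 1 ≤ t → u (t + 1) ≤ u t + t * θ t) :
    Tendsto (fun t : ℕ => u t / (t : ℝ) ^ 2) atTop (𝓝 0) := by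
  -- Bounding each weight s < t by t leaves a Cesàro mean of |θ| after division by t².
  have hb : ∀ t : ℕ, 1 ≤ t → u t ≤ u 1 + t * ∑ s ∈ Finset.range t, |θ s| := by
    intro t ht
    induction t, ht using Nat.le_induction with
    | base => simp
    | succ t ht ih =>
      have h1 := h t ht
      have h2 : (t : ℝ) * θ t ≤ (t + 1 : ℝ) * |θ t| :=
        (mul_le_mul_of_nonneg_left (le_abs_self _) t.cast_nonneg).trans
          (mul_le_mul_of_nonneg_right (by linarith) (abs_nonneg _))
      have h3 : 0 ≤ ∑ s ∈ Finset.range t, |θ s| := Finset.sum_nonneg fun _ _ => abs_nonneg _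
      rw [Finset.sum_range_succ]
      push_cast
      linarith
  have h0 : Tendsto (fun t : ℕ => u 1 / (t : ℝ) ^ 2 + (t : ℝ)⁻¹ * ∑ s ∈ Finset.range t, |θ s|)
      atTop (𝓝 (0 + 0)) := by
    refine Tendsto.add ?_ ?_
    · exact tendsto_const_nhds.div_atTop
        ((tendsto_pow_atTop two_ne_zero).comp tendsto_natCast_atTop_atTop)
    · have := hθ.abs
      rw [abs_zero] at this
      exact this.cesaro
  rw [add_zero] at h0
  refine tendsto_of_tendsto_of_tendsto_of_le_of_le' tendsto_const_nhds h0
    (Eventually.of_forall fun t => div_nonneg (hu t) (by positivity)) ?_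
  filter_upwards [eventually_ge_atTop 1] with t ht
  have ht' : (0 : ℝ) < t := by exact_mod_cast ht
  refine (div_le_div_of_nonneg_right (hb t ht) (by positivity)).trans_eq ?_
  field_simp

/-- For uniformly bounded functions, convergence in measure to zero implies convergence in mean. -/
theorem MeasureTheory.TendstoInMeasure.tendsto_integral_abs {Ω : Type*} [MeasurableSpace Ω]
    {μ : Measure Ω} [IsProbabilityMeasure μ] {f : ℕ → Ω → ℝ} {C : ℝ}
    (h : TendstoInMeasure μ f atTop fun _ => 0) (hf : ∀ᶠ t in atTop, Measurable (f t))
    (hC : ∀ᶠ t in atTop, ∀ᵐ ω ∂μ, |f t ω| ≤ C) :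
    Tendsto (fun t => ∫ ω, |f t ω| ∂μ) atTop (𝓝 0) := by
  -- Split at |f| = ε: below it the integrand is at most ε, above it at most C.
  have hbound : ∀ ε > 0, ∀ᶠ t in atTop,
      ∫ ω, |f t ω| ∂μ ≤ ε + C * μ.real {ω | ε ≤ ‖f t ω - 0‖} := by
    intro ε hε
    filter_upwards [hf, hC] with t h1 h2
    have hA : MeasurableSet {ω | ε ≤ ‖f t ω - 0‖} :=
      measurableSet_le measurable_const (h1.sub_const 0).norm
    have hi : Integrable ({ω | ε ≤ ‖f t ω - 0‖}.indicator fun _ => C) μ :=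
      (integrable_const C).indicator hA
    calc ∫ ω, |f t ω| ∂μ
        ≤ ∫ ω, (ε + {ω | ε ≤ ‖f t ω - 0‖}.indicator (fun _ => C) ω) ∂μ := by
          refine integral_mono_ae ?_ ((integrable_const ε).add hi) ?_
          · exact (Integrable.of_bound h1.aestronglyMeasurable C h2).abs
          · filter_upwards [h2] with ω hω
            by_cases hm : ω ∈ {ω | ε ≤ ‖f t ω - 0‖}
            · rw [Set.indicator_of_mem hm]
              linarith
            · rw [Set.indicator_of_notMem hm, add_zero]
              have hm' : ¬ε ≤ ‖f t ω - 0‖ := hm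
              simpa using (not_le.1 hm').le
      _ = ε + C * μ.real {ω | ε ≤ ‖f t ω - 0‖} := by
          rw [integral_add (integrable_const ε) hi, integral_indicator_const _ hA]
          simp [mul_comm]
  rw [tendstoInMeasure_iff_measureReal_norm] at h
  refine tendsto_order.2 ⟨fun a ha => Eventually.of_forall fun t =>
    ha.trans_le (integral_nonneg fun _ => abs_nonneg _), fun a ha => ?_⟩
  have hl : Tendsto (fun t => a / 2 + C * μ.real {ω | a / 2 ≤ ‖f t ω - 0‖}) atTop
      (𝓝 (a / 2 + C * 0)) := ((h (a / 2) (half_pos ha)).const_mul C).const_add _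
  filter_upwards [hbound (a / 2) (half_pos ha), hl.eventually_lt_const (u := a) (by linarith)]
    with t h1 h2 using h1.trans_lt h2

/-- Convergence in mean square implies convergence in measure. -/
theorem tendstoInMeasure_of_tendsto_integral_sq {Ω : Type*} [MeasurableSpace Ω]
    {μ : Measure Ω} [IsProbabilityMeasure μ] {f : ℕ → Ω → ℝ}
    (hf : ∀ᶠ t in atTop, Integrable (fun ω => f t ω ^ 2) μ)
    (h : Tendsto (fun t => ∫ ω, f t ω ^ 2 ∂μ) atTop (𝓝 0)) :
    TendstoInMeasure μ f atTop fun _ => 0 := by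
  rw [tendstoInMeasure_iff_measureReal_norm]
  intro ε hε
  have hl := h.const_mul (ε ^ 2)⁻¹
  rw [mul_zero] at hl
  refine tendsto_of_tendsto_of_tendsto_of_le_of_le' tendsto_const_nhds hl
    (Eventually.of_forall fun t => measureReal_nonneg) ?_
  filter_upwards [hf] with t ht
  -- Markov's inequality for f² at level ε².
  have := mul_meas_ge_le_integral_of_nonneg (Eventually.of_forall fun ω => sq_nonneg (f t ω)) ht
    (ε ^ 2)
  rw [le_inv_mul_iff₀ (by positivity)]
  refine le_trans (mul_le_mul_of_nonneg_left ?_ (by positivity)) this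
  refine measureReal_mono fun ω hω => ?_
  have hω' : ε ≤ |f t ω| := by simpa using hω
  exact (pow_le_pow_left₀ hε.le hω' 2).trans_eq (sq_abs _)

/-! ### Second moments and induction on the degree. -/

namespace IsRWSB

open Multigraph

theorem eventually_measurable_comp {Ω : Type*} [MeasurableSpace Ω] {μ : Measure Ω} {α : ℝ}
    {P : PMF ℕ} {G : ℕ → Ω → Multigraph} (hG : IsRWSB μ α P G)
    (F : ℕ → Multigraph → ℝ) :
    ∀ᶠ t in atTop, Measurable fun ω => F t (G t ω) := by
  filter_upwards [eventually_ge_atTop 1] with t ht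
  exact (Measurable.of_discrete (f := F t)).comp (hG.measurable t ht)

variable {Ω : Type*} [MeasurableSpace Ω] {μ : Measure Ω} [IsProbabilityMeasure μ]
  {α : ℝ} {P : PMF ℕ} {G : ℕ → Ω → Multigraph}

theorem tendsto_integral_returnMass (hG : IsRWSB μ α P G)
    (hloop : ∀ d : ℕ, 1 ≤ d →
      TendstoInMeasure μ (fun t ω => (G t ω).avgReturn P d) atTop (fun _ => (0 : ℝ))) (d : ℕ) :
    Tendsto (fun t => ∫ ω, returnMass P d (G t ω) ∂μ) atTop (𝓝 0) := by
  rcases Nat.eq_zero_or_pos d with rfl | hd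
  -- Index 0 arises from the truncated d − 1 and d − 2; `hloop` does not cover it, but reachable
  -- graphs have no isolated vertices.
  · refine tendsto_const_nhds.congr' ?_
    filter_upwards [eventually_ge_atTop 1] with t ht
    rw [integral_congr_ae ((hG.ae_reachable ht).mono fun ω hω => hω.returnMass_zero P),
      integral_zero]
  · have hb : ∀ᶠ t in atTop, ∀ᵐ ω ∂μ, |(G t ω).avgReturn P d| ≤ 1 := by
      filter_upwards [eventually_ge_atTop 1] with t ht
      filter_upwards [hG.ae_reachable ht] with ω hω
      rw [abs_of_nonneg (avgReturn_nonneg P d _)]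
      exact avgReturn_le_one hω.deg_pos P d
    refine tendsto_of_tendsto_of_tendsto_of_le_of_le' tendsto_const_nhds
      ((hloop d hd).tendsto_integral_abs
        (hG.eventually_measurable_comp fun _ g => g.avgReturn P d) hb)
      (Eventually.of_forall fun t => integral_nonneg fun ω => returnMass_nonneg P d _) ?_
    filter_upwards [eventually_ge_atTop 1] with t ht
    refine integral_mono_ae (hG.integrable_comp ht _)
      (hG.integrable_comp ht fun g => |g.avgReturn P d|) ?_
    filter_upwards [hG.ae_reachable ht] with ω hω
    exact (hω.returnMass_le_avgReturn ht P d).trans (le_abs_self _)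

theorem tendsto_integral_abs_loopError (hG : IsRWSB μ α P G)
    (hloop : ∀ d : ℕ, 1 ≤ d →
      TendstoInMeasure μ (fun t ω => (G t ω).avgReturn P d) atTop (fun _ => (0 : ℝ))) (d : ℕ) :
    Tendsto (fun t => ∫ ω, |loopError P d (G t ω)| ∂μ) atTop (𝓝 0) := by
  have hlim := ((hG.tendsto_integral_returnMass hloop (d - 2)).add
    ((hG.tendsto_integral_returnMass hloop (d - 1)).const_mul 2)).add
    (hG.tendsto_integral_returnMass hloop d)
  simp only [mul_zero, add_zero] at hlim
  refine tendsto_of_tendsto_of_tendsto_of_le_of_le' tendsto_const_nhds hlim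
    (Eventually.of_forall fun t => integral_nonneg fun ω => abs_nonneg _) ?_
  filter_upwards [eventually_ge_atTop 1] with t ht
  have hi := fun j => hG.integrable_comp ht (returnMass P j)
  rw [← integral_const_mul, ← integral_add (hi _) ((hi _).const_mul 2),
    ← integral_add (hG.integrable_comp ht fun g =>
      returnMass P (d - 2) g + 2 * returnMass P (d - 1) g) (hi _)]
  refine integral_mono_ae (hG.integrable_comp ht fun g => |loopError P d g|)
    (((hi _).add ((hi _).const_mul 2)).add (hi _)) ?_
  filter_upwards [hG.ae_reachable ht] with ω hω using hω.abs_loopError_le P d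

/-- One-step growth of the second moment of the deviation of `degCount d` from linear growth `κ t`,
where the conditional drift of the deviation is mean-reverting up to an error `e`. -/
theorem integral_sq_succ_le (hG : IsRWSB μ α P G) {t : ℕ} (ht : 1 ≤ t) {d : ℕ} {κ c : ℝ}
    (hc : 0 ≤ c) {e : Multigraph → ℝ}
    (he : ∀ g, Reachable t g → stepMean α P g (fun h => (h.degCount d : ℝ) - g.degCount d) - κ =
      -(c / t) * (g.degCount d - κ * t) + e g) :
    ∫ ω, ((G (t + 1) ω).degCount d - κ * ((t + 1 : ℕ) : ℝ)) ^ 2 ∂μ ≤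
      ∫ ω, ((G t ω).degCount d - κ * t) ^ 2 ∂μ +
        t * (2 * (2 + |κ|) * ∫ ω, |e (G t ω)| ∂μ + (4 + |κ|) ^ 2 / t) := by
  have ht' : (0 : ℝ) < t := by exact_mod_cast ht
  let y : Multigraph → ℝ := fun g => g.degCount d - κ * t
  let Δ : Multigraph → Multigraph → ℝ := fun g h => (h.degCount d : ℝ) - g.degCount d - κ
  -- The 2 comes from m_d ≤ t + 1 ≤ 2t.
  have hy : ∀ g, Reachable t g → |y g| ≤ (2 + |κ|) * t := by
    intro g hg
    have h1 : (g.degCount d : ℝ) ≤ t + 1 := by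
      exact_mod_cast (degCount_le g d).trans hg.card_le
    have h2 : (1 : ℝ) ≤ t := by exact_mod_cast ht
    calc |y g| ≤ |(g.degCount d : ℝ)| + |κ * t| := abs_sub _ _
      _ = g.degCount d + |κ| * t := by rw [Nat.abs_cast, abs_mul, abs_of_pos ht']
      _ ≤ (2 + |κ|) * t := by linarith
  have hcross : ∫ ω, y (G t ω) * Δ (G t ω) (G (t + 1) ω) ∂μ ≤
      (2 + |κ|) * t * ∫ ω, |e (G t ω)| ∂μ := by
    rw [hG.integral_comp_pair ht fun g h => y g * Δ g h, ← integral_const_mul]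
    refine integral_mono_ae (hG.integrable_comp ht fun g => stepMean α P g fun h => y g * Δ g h)
      (hG.integrable_comp ht fun g => (2 + |κ|) * t * |e g|) ?_
    filter_upwards [hG.ae_reachable ht] with ω hω
    rw [stepMean_const_mul, hω.stepMean_sub_const ht, he _ hω]
    have h1 : y (G t ω) * e (G t ω) ≤ (2 + |κ|) * t * |e (G t ω)| := by
      refine (le_abs_self _).trans ?_
      rw [abs_mul]
      exact mul_le_mul_of_nonneg_right (hy _ hω) (abs_nonneg _)
    -- Mean reversion enters only here: this term has a favourable sign and is dropped.
    have h2 : 0 ≤ c / t * y (G t ω) ^ 2 := by positivity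
    calc y (G t ω) * (-(c / t) * y (G t ω) + e (G t ω))
        = y (G t ω) * e (G t ω) - c / t * y (G t ω) ^ 2 := by ring
      _ ≤ _ := by linarith
  have hquad : ∫ ω, Δ (G t ω) (G (t + 1) ω) ^ 2 ∂μ ≤ (4 + |κ|) ^ 2 := by
    have h1 : ∫ _ : Ω, (4 + |κ|) ^ 2 ∂μ = (4 + |κ|) ^ 2 := by simp
    rw [← h1]
    refine integral_mono_ae (hG.integrable_comp_pair ht fun g h => Δ g h ^ 2)
      (integrable_const _) ?_
    filter_upwards [hG.ae_abs_degCount_sub_le ht d] with ω hω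
    refine sq_le_sq' ?_ ?_
    · exact (abs_le.1 ((abs_sub _ κ).trans (add_le_add_left hω |κ|))).1
    · exact (abs_le.1 ((abs_sub _ κ).trans (add_le_add_left hω |κ|))).2
  have hexp : ∫ ω, ((G (t + 1) ω).degCount d - κ * ((t + 1 : ℕ) : ℝ)) ^ 2 ∂μ =
      ∫ ω, y (G t ω) ^ 2 ∂μ + 2 * ∫ ω, y (G t ω) * Δ (G t ω) (G (t + 1) ω) ∂μ +
        ∫ ω, Δ (G t ω) (G (t + 1) ω) ^ 2 ∂μ := by
    have hi1 := hG.integrable_comp ht fun g => y g ^ 2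
    have hi2 := (hG.integrable_comp_pair ht fun g h => y g * Δ g h).const_mul 2
    have hi12 := hG.integrable_comp_pair ht fun g h => y g ^ 2 + 2 * (y g * Δ g h)
    have hi3 := hG.integrable_comp_pair ht fun g h => Δ g h ^ 2
    rw [← integral_const_mul, ← integral_add hi1 hi2, ← integral_add hi12 hi3]
    refine integral_congr_ae (Eventually.of_forall fun ω => ?_)
    simp only [y, Δ]
    push_cast
    ring
  rw [hexp, mul_add, mul_div_cancel₀ _ ht'.ne']
  have : (t : ℝ) * (2 * (2 + |κ|) * ∫ ω, |e (G t ω)| ∂μ) =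
    2 * ((2 + |κ|) * t * ∫ ω, |e (G t ω)| ∂μ) := by ring
  rw [this]
  exact add_le_add (add_le_add_right (mul_le_mul_of_nonneg_left hcross zero_le_two) _) hquad |>.trans
    (add_assoc _ _ _).le

theorem tendstoInMeasure_degCount (hG : IsRWSB μ α P G) {κ c : ℝ} (hc : 0 ≤ c) {d : ℕ}
    {e : ℕ → Multigraph → ℝ}
    (he : ∀ t, 1 ≤ t → ∀ g, Reachable t g →
      stepMean α P g (fun h => (h.degCount d : ℝ) - g.degCount d) - κ =
        -(c / t) * (g.degCount d - κ * t) + e t g)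
    (hlim : Tendsto (fun t => ∫ ω, |e t (G t ω)| ∂μ) atTop (𝓝 0)) :
    TendstoInMeasure μ (fun t ω => ((G t ω).degCount d : ℝ) / t - κ) atTop fun _ => 0 := by
  have hθ : Tendsto (fun t : ℕ => 2 * (2 + |κ|) * ∫ ω, |e t (G t ω)| ∂μ + (4 + |κ|) ^ 2 / t) atTop
      (𝓝 0) := by
    simpa using (hlim.const_mul (2 * (2 + |κ|))).add
      (tendsto_const_nhds (x := (4 + |κ|) ^ 2).div_atTop tendsto_natCast_atTop_atTop)
  have hsq := tendsto_div_sq_of_le_add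
    (u := fun t => ∫ ω, ((G t ω).degCount d - κ * (t : ℝ)) ^ 2 ∂μ)
    (fun t => integral_nonneg fun ω => sq_nonneg _) hθ
    fun t ht => hG.integral_sq_succ_le ht hc (he t ht)
  refine tendstoInMeasure_of_tendsto_integral_sq ?_ (hsq.congr' ?_)
  · filter_upwards [eventually_ge_atTop 1] with t ht
    exact hG.integrable_comp ht fun g => ((g.degCount d : ℝ) / t - κ) ^ 2
  · filter_upwards [eventually_ge_atTop 1] with t ht
    have ht' : (0 : ℝ) < t := by exact_mod_cast ht
    rw [← integral_div]
    refine integral_congr_ae (Eventually.of_forall fun ω => ?_)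
    simp only
    field_simp

/-- Feeds the induction: the limit for d has to enter the error term for d + 1 in mean, not just in
probability. -/
theorem tendsto_integral_abs_degCount (hG : IsRWSB μ α P G) {κ : ℝ} {d : ℕ}
    (h : TendstoInMeasure μ (fun t ω => ((G t ω).degCount d : ℝ) / t - κ) atTop fun _ => 0) :
    Tendsto (fun t : ℕ => ∫ ω, |((G t ω).degCount d : ℝ) / t - κ| ∂μ) atTop (𝓝 0) := by
  refine h.tendsto_integral_abs (C := 2 + |κ|)
    (hG.eventually_measurable_comp fun t g => (g.degCount d : ℝ) / t - κ) ?_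
  filter_upwards [eventually_ge_atTop 1] with t ht
  filter_upwards [hG.ae_reachable ht] with ω hω
  have h1 : ((G t ω).degCount d : ℝ) ≤ t + 1 := by
    exact_mod_cast (degCount_le _ d).trans hω.card_le
  have h2 : (1 : ℝ) ≤ t := by exact_mod_cast ht
  refine (abs_sub _ _).trans (add_le_add_left ?_ _)
  rw [abs_of_nonneg (by positivity), div_le_iff₀ (by linarith)]
  linarith

theorem tendstoInMeasure_degCount_div (hG : IsRWSB μ α P G) {ρ : ℝ} (hρ : 0 < ρ)
    (hαρ : (2 - α) / 2 * ρ = 1)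
    (hloop : ∀ d : ℕ, 1 ≤ d →
      TendstoInMeasure μ (fun t ω => (G t ω).avgReturn P d) atTop (fun _ => (0 : ℝ)))
    {d : ℕ} (hd : 1 ≤ d) :
    TendstoInMeasure μ (fun t ω => ((G t ω).degCount d : ℝ) / t - α * yuleSimon ρ d) atTop
      fun _ => 0 := by
  have hb : 0 < (2 - α) / 2 := pos_of_mul_pos_left (hαρ ▸ one_pos) hρ.le
  -- The factor d − 1 makes the premise trivial at d = 1, so one argument serves the base case and
  -- the inductive step.
  have main : ∀ d : ℕ, 1 ≤ d → Tendsto (fun t : ℕ => ((d : ℝ) - 1) *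
      ∫ ω, |((G t ω).degCount (d - 1) : ℝ) / t - α * yuleSimon ρ (d - 1)| ∂μ) atTop (𝓝 0) →
      TendstoInMeasure μ (fun t ω => ((G t ω).degCount d : ℝ) / t - α * yuleSimon ρ d) atTop
        fun _ => 0 := by
    intro d hd hprev
    let e₁ : ℕ → Multigraph → ℝ := fun t g =>
      (g.degCount (d - 1) : ℝ) / t - α * yuleSimon ρ (d - 1)
    refine hG.tendstoInMeasure_degCount (c := (2 - α) / 2 * d) (by positivity)
      (e := fun t g => (2 - α) / 2 * ((d : ℝ) - 1) * e₁ t g + (1 - α) * loopError P d g) ?_ ?_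
    · intro t ht g hg
      have ht' : (t : ℝ) ≠ 0 := by positivity
      have hrec := yuleSimon_recurrence hρ hd
      -- The Yule–Simon recurrence multiplied by α(2 − α)/2, with ρ eliminated: the constant terms
      -- of the drift balance.
      have hrec' : α * yuleSimon ρ d + (2 - α) / 2 * d * (α * yuleSimon ρ d) =
          α * (if d = 1 then 1 else 0) + (2 - α) / 2 * (d - 1) * (α * yuleSimon ρ (d - 1)) := by
        linear_combination (2 - α) / 2 * α * hrec +
          (α * (if d = 1 then 1 else 0) - α * yuleSimon ρ d) * hαρ
      rw [hg.stepMean_degCount ht α P hd]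
      have h1 : (2 - α) * ((((d : ℝ) - 1) * g.degCount (d - 1) - d * g.degCount d) / (2 * t)) =
          (2 - α) / 2 * (d - 1) * (g.degCount (d - 1) / t) -
            (2 - α) / 2 * d * (g.degCount d / t) := by
        field_simp
      have h2 : -((2 - α) / 2 * d / t) * (g.degCount d - α * yuleSimon ρ d * t) =
          -((2 - α) / 2 * d) * (g.degCount d / t) + (2 - α) / 2 * d * (α * yuleSimon ρ d) := by
        field_simp
        ring
      rw [h1, h2]
      simp only [e₁]
      linear_combination -hrec'
    · have hl := (hprev.const_mul ((2 - α) / 2)).add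
        ((hG.tendsto_integral_abs_loopError hloop d).const_mul |1 - α|)
      simp only [mul_zero, add_zero] at hl
      refine tendsto_of_tendsto_of_tendsto_of_le_of_le' tendsto_const_nhds hl
        (Eventually.of_forall fun t => integral_nonneg fun ω => abs_nonneg _) ?_
      filter_upwards [eventually_ge_atTop 1] with t ht
      have hi1 := hG.integrable_comp ht fun g => |e₁ t g|
      have hi2 := hG.integrable_comp ht fun g => |loopError P d g|
      rw [← mul_assoc, ← integral_const_mul, ← integral_const_mul,
        ← integral_add (hi1.const_mul _) (hi2.const_mul _)]
      refine integral_mono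
        (hG.integrable_comp ht fun g => |(2 - α) / 2 * ((d : ℝ) - 1) * e₁ t g +
          (1 - α) * loopError P d g|) ((hi1.const_mul _).add (hi2.const_mul _)) fun ω => ?_
      refine (abs_add_le _ _).trans_eq ?_
      have hd' : (0 : ℝ) ≤ d - 1 := sub_nonneg.2 (by exact_mod_cast hd)
      rw [abs_mul, abs_mul (1 - α), abs_of_nonneg (mul_nonneg hb.le hd')]
  induction d, hd using Nat.le_induction with
  | base => exact main 1 le_rfl (by simp)
  | succ d hd ih =>
    refine main (d + 1) (Nat.le_add_left 1 d) ?_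
    simpa using (hG.tendsto_integral_abs_degCount ih).const_mul (((d + 1 : ℕ) : ℝ) - 1)

end IsRWSB

theorem theorem3p3 {Ω : Type*} [MeasurableSpace Ω] (μ : Measure Ω) [IsProbabilityMeasure μ]
    (α : ℝ) (hα₀ : 0 < α) (hα₁ : α ≤ 1) (P : PMF ℕ)
    (G : ℕ → Ω → Multigraph) (hG : IsRWSB μ α P G)
    (hloop : ∀ d : ℕ, 1 ≤ d →
      TendstoInMeasure μ (fun t ω => (G t ω).avgReturn P d) atTop (fun _ => (0 : ℝ)))
    (ρ : ℝ) (hρ : ρ = 1 + α / (2 - α)) :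
    (∀ d : ℕ, 1 ≤ d →
      TendstoInMeasure μ (fun t ω => ((G t ω).degCount d : ℝ) / (α * (t : ℝ))) atTop
        (fun _ => yuleSimon ρ d)) ∧
    (fun d : ℕ => yuleSimon ρ d) ~[atTop]
      (fun d : ℕ => ρ * Real.Gamma (1 + ρ) * (d : ℝ) ^ (-(1 + ρ))) := by
  have h2 : 0 < 2 - α := by linarith
  have hρ₀ : 0 < ρ := by rw [hρ]; positivity
  have hαρ : (2 - α) / 2 * ρ = 1 := by
    rw [hρ]
    field_simp
    ring
  refine ⟨fun d hd => ?_, yuleSimon_isEquivalent hρ₀⟩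
  have h := hG.tendstoInMeasure_degCount_div hρ₀ hαρ hloop hd
  rw [tendstoInMeasure_iff_measureReal_norm] at h ⊢
  intro ε hε
  -- The deviation of m_d/t from α·p_d is α times that of m_d/(αt) from p_d, so the two events
  -- coincide.
  convert h (α * ε) (mul_pos hα₀ hε) using 5 with t ω
  have h3 : ((G t ω).degCount d : ℝ) / t - α * yuleSimon ρ d - 0 =
      α * (((G t ω).degCount d : ℝ) / (α * t) - yuleSimon ρ d) := by
    rw [sub_zero, mul_sub, ← mul_div_assoc, mul_div_mul_left _ _ hα₀.ne']
  rw [h3, norm_mul, Real.norm_of_nonneg hα₀.le, mul_le_mul_iff_right₀ hα₀]
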